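/- For a positive integer $n$, let $D(n)$ denote the difference between the largest and the smallest coefficient of the $n$th cyclotomic polynomial $\Phi_n$. Let $p$ be an odd prime. For an integer $d$, say that $D(pqr)=d$ is soluble in arbitrarily large primes if for every $N$ there are primes $q$ and $r$ with $q,r>N$, $p<q<r$ and $D(pqr)=d$. Then $D(pqr)=d$ is soluble in arbitrarily large primes for each of the following values of $d$: 1. $d=2$; 2. $d=2h$, for each integer $h$ with $3\le h<\sqrt p$; 3. $d=p$; 4. $d=p-2k$, for each integer $k$ with $1\le k<\sqrt p/2-1$. -/

import Mathlib

/-- The largest coefficient of an integer polynomial `f`, among the coefficients of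
`x ^ m` with `0 ≤ m ≤ deg f`. -/
def maxCoeff (f : Polynomial ℤ) : ℤ :=
  (Finset.range (f.natDegree + 1)).sup' ⟨0, by simp⟩ f.coeff

/-- The smallest coefficient of an integer polynomial `f`, among the coefficients of
`x ^ m` with `0 ≤ m ≤ deg f`. -/
def minCoeff (f : Polynomial ℤ) : ℤ :=
  (Finset.range (f.natDegree + 1)).inf' ⟨0, by simp⟩ f.coeff

/-- The diameter `D(n)` of the `n`-th cyclotomic polynomial: the difference between its
largest and its smallest coefficient. -/
noncomputable def cyclotomicDiameter (n : ℕ) : ℤ :=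
  maxCoeff (Polynomial.cyclotomic n ℤ) - minCoeff (Polynomial.cyclotomic n ℤ)

/-- There are arbitrarily large primes `q` and `r`, with `p < q < r`, such that
`D(p q r) = d`. -/
def SolubleInLargePrimes (p : ℕ) (d : ℤ) : Prop :=
  ∀ N : ℕ, ∃ q r : ℕ, q.Prime ∧ r.Prime ∧ N < q ∧ N < r ∧ p < q ∧ q < r ∧
    cyclotomicDiameter (p * q * r) = d

/-!
The coefficients of `Φ_{pq}` are first differences of the indicator of the numerical semigroup
`⟨p, q⟩`, and a residue class modulo `p` with least semigroup element `j * q` meets the semigroup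
exactly from `j * q` on. Kaplan's lemma expresses a coefficient of `Φ_{pqr}` as a difference of two
sums of coefficients of `Φ_{pq}` over windows of `p` exponents with difference `u = r⁻¹` modulo
`pq`. When `u * p < q`, it follows that the coefficients of `Φ_{pqr}` are, up to sign, sums of
coefficients of `Φ_{pq}` over progressions of at most `p` exponents with difference `u`.

Choose `q` and `r` by Dirichlet's theorem so that `u * e ≡ 1` and `q ≡ ± u` modulo `p`, where
`2 * e < p`. Since `x + u * e - 1 ≡ x` modulo `p`, such a sum telescopes along the residue classes
up to `e` terms at either end, hence is at most `e`; the telescoping defect is at most `1`, since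
the progression is shorter than `q`. For `q ≡ -u` the defect never worsens the lower bound, so the
sums range from `-e` to `e` and `D(pqr) = 2e`. For `q ≡ u` it can, but only around the multiples
`j * q` with `e ≤ j < p - e`. If `u` or `-u` has a residue in `[1, e]` modulo `p`, such progressions
occur for one sign only, and `D(pqr) = 2e + 1`.
-/

open Polynomial

section Semigroup

/-- The indicator function on `ℤ` of the numerical semigroup generated by `p` and `q`. -/
noncomputable def semigroupIndicator (p q : ℕ) : ℤ → ℤ :=
  Set.indicator (AddSubmonoid.closure {(p : ℤ), (q : ℤ)} : Set ℤ) 1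

/-- The coefficient sequence of `Φ_{pq}`, extended by zero to all integer exponents
(see `coeff_cyclotomic_mul_prime`). -/
noncomputable def binaryCoeff (p q : ℕ) (z : ℤ) : ℤ :=
  semigroupIndicator p q z - semigroupIndicator p q (z - 1)

theorem semigroupIndicator_nonneg (p q : ℕ) (z : ℤ) : 0 ≤ semigroupIndicator p q z :=
  Set.indicator_nonneg (fun _ _ => zero_le_one) z

theorem semigroupIndicator_le_one (p q : ℕ) (z : ℤ) : semigroupIndicator p q z ≤ 1 :=
  Set.indicator_le_self' (fun _ _ => zero_le_one) z

theorem abs_binaryCoeff_le_one (p q : ℕ) (z : ℤ) : |binaryCoeff p q z| ≤ 1 :=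
  abs_sub_le_of_nonneg_of_le (semigroupIndicator_nonneg p q z) (semigroupIndicator_le_one p q z)
    (semigroupIndicator_nonneg p q (z - 1)) (semigroupIndicator_le_one p q (z - 1))

theorem semigroupIndicator_of_neg {p q : ℕ} {z : ℤ} (hz : z < 0) :
    semigroupIndicator p q z = 0 := by
  refine Set.indicator_of_notMem (fun hmem => hz.not_ge ?_) _
  obtain ⟨a, b, rfl⟩ := (AddSubmonoid.mem_closure_pair _ _ _).1 hmem
  positivity

theorem binaryCoeff_of_neg {p q : ℕ} {z : ℤ} (hz : z < 0) : binaryCoeff p q z = 0 := by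
  rw [binaryCoeff, semigroupIndicator_of_neg hz, semigroupIndicator_of_neg (by lia), sub_zero]

variable {p q : ℕ}

theorem semigroupIndicator_le_of_modEq (hp : 0 < p) {y z : ℤ} (hyz : y ≤ z)
    (h : y ≡ z [ZMOD p]) : semigroupIndicator p q y ≤ semigroupIndicator p q z := by
  by_cases hy : y ∈ AddSubmonoid.closure {(p : ℤ), (q : ℤ)}
  · obtain ⟨c, hc⟩ := h.dvd
    lift c to ℕ using by nlinarith
    have hz : z ∈ AddSubmonoid.closure {(p : ℤ), (q : ℤ)} := by
      rw [show z = c • (p : ℤ) + y by rw [nsmul_eq_mul]; linarith]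
      exact add_mem (nsmul_mem (AddSubmonoid.subset_closure (by simp)) c) hy
    rw [semigroupIndicator, Set.indicator_of_mem hy, Set.indicator_of_mem hz]
    exact le_rfl
  · rw [semigroupIndicator, Set.indicator_of_notMem hy]
    exact semigroupIndicator_nonneg p q z

theorem modEq_of_mul_modEq_mul_right (hpq : p.Coprime q) (hp : 0 < p) {i j : ℤ}
    (h : i * q ≡ j * q [ZMOD p]) : i ≡ j [ZMOD p] := by
  simpa [hpq.gcd_eq_one] using h.cancel_right_div_gcd (Int.natCast_pos.2 hp)

/-- A semigroup element congruent to `j * q` is `a * p + b * q` with `b ≡ j`, hence `j ≤ b`. -/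
theorem mem_closure_iff_mul_le_of_modEq (hpq : p.Coprime q) {z j : ℤ} (hj : 0 ≤ j)
    (hjp : j < p) (hz : z ≡ j * q [ZMOD p]) :
    z ∈ AddSubmonoid.closure {(p : ℤ), (q : ℤ)} ↔ j * q ≤ z := by
  rw [AddSubmonoid.mem_closure_pair]
  simp only [nsmul_eq_mul]
  constructor
  · rintro ⟨a, b, rfl⟩
    have hbj : (b : ℤ) ≡ j [ZMOD p] := by
      refine modEq_of_mul_modEq_mul_right hpq (by lia) ((Int.ModEq.symm ?_).trans hz)
      rw [mul_comm (a : ℤ), add_comm]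
      exact Int.modEq_add_fac_self
    have hjb : j ≤ b := by
      rw [← Int.emod_eq_of_lt hj hjp, ← hbj.eq]
      exact_mod_cast Nat.mod_le b p
    nlinarith [Int.natCast_nonneg (a * p), Nat.cast_mul (α := ℤ) a p]
  · intro hle
    obtain ⟨c, hc⟩ := hz.symm.dvd
    lift c to ℕ using by nlinarith
    lift j to ℕ using hj
    exact ⟨c, j, by linarith⟩

theorem semigroupIndicator_eq_ite (hpq : p.Coprime q) {z j : ℤ} (hj : 0 ≤ j) (hjp : j < p)
    (hz : z ≡ j * q [ZMOD p]) : semigroupIndicator p q z = if j * q ≤ z then 1 else 0 := by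
  classical
  rw [semigroupIndicator, Set.indicator_apply]
  exact if_congr (mem_closure_iff_mul_le_of_modEq hpq hj hjp hz) rfl rfl

theorem semigroupIndicator_eq_ite_of_mem_block (hpq : p.Coprime q) {z j J : ℤ} (hj : 0 ≤ j)
    (hjp : j < p) (hz : z ≡ j * q [ZMOD p]) (hJ : J * q ≤ z) (hJ' : z < (J + 1) * q) :
    semigroupIndicator p q z = if j ≤ J then 1 else 0 := by
  rw [semigroupIndicator_eq_ite hpq hj hjp hz]
  have hq : (0 : ℤ) < q := by linarith
  refine if_congr ⟨fun h => ?_, fun h => ?_⟩ rfl rfl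
  · exact Int.lt_add_one_iff.1 (lt_of_mul_lt_mul_right (h.trans_lt hJ') hq.le)
  · exact (mul_le_mul_of_nonneg_right h hq.le).trans hJ

theorem exists_modEq_mul_of_coprime (hpq : p.Coprime q) (hp : 0 < p) (z : ℤ) :
    ∃ j : ℤ, 0 ≤ j ∧ j < p ∧ z ≡ j * q [ZMOD p] := by
  obtain ⟨y, hy⟩ := Int.mod_coprime hpq.symm
  obtain ⟨j, hj, hjp, hjz⟩ := Int.existsUnique_equiv (z * y) (Int.natCast_pos.2 hp)
  refine ⟨j, hj, hjp, ?_⟩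
  calc z = z * 1 := (mul_one z).symm
    _ ≡ z * (q * y) [ZMOD p] := (hy.mul_left z).symm
    _ = z * y * q := by ring
    _ ≡ j * q [ZMOD p] := (hjz.mul_right q).symm

/-- The number `j * q` is the least semigroup element of its residue class modulo `p`. -/
theorem exists_modEq_mul_and_lt_of_semigroupIndicator_lt (hpq : p.Coprime q) (hp : 0 < p)
    {y z : ℤ} (h : y ≡ z [ZMOD p]) (hlt : semigroupIndicator p q y < semigroupIndicator p q z) :
    ∃ j : ℤ, 0 ≤ j ∧ j < p ∧ y ≡ j * q [ZMOD p] ∧ y < j * q ∧ j * q ≤ z := by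
  obtain ⟨j, hj, hjp, hjy⟩ := exists_modEq_mul_of_coprime hpq hp y
  rw [semigroupIndicator_eq_ite hpq hj hjp hjy,
    semigroupIndicator_eq_ite hpq hj hjp (h.symm.trans hjy)] at hlt
  exact ⟨j, hj, hjp, hjy, by grind⟩

theorem semigroupIndicator_of_frobenius_lt (hpq : p.Coprime q) (hp : 0 < p) {z : ℤ}
    (hz : (p : ℤ) * q - p - q < z) : semigroupIndicator p q z = 1 := by
  obtain ⟨j, hj, hjp, hjz⟩ := exists_modEq_mul_of_coprime hpq hp z
  rw [semigroupIndicator_eq_ite hpq hj hjp hjz, if_pos]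
  by_contra! hlt
  have hle : (p : ℤ) ≤ j * q - z := Int.le_of_dvd (by linarith) hjz.dvd
  nlinarith

theorem binaryCoeff_of_frobenius_lt (hpq : p.Coprime q) (hp : 0 < p) {z : ℤ}
    (hz : (p : ℤ) * q - p - q + 1 < z) : binaryCoeff p q z = 0 := by
  rw [binaryCoeff, semigroupIndicator_of_frobenius_lt hpq hp (by linarith),
    semigroupIndicator_of_frobenius_lt hpq hp (by linarith), sub_self]

theorem semigroupIndicator_sub (hpq : p.Coprime q) (hp : 0 < p) (z : ℤ) :
    semigroupIndicator p q z - semigroupIndicator p q (z - p) =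
      ∑ j ∈ Finset.range p, if z = j * q then 1 else 0 := by
  obtain ⟨j, hj, hjp, hjz⟩ := exists_modEq_mul_of_coprime hpq hp z
  have hz' : z - p ≡ j * q [ZMOD p] := by simpa using hjz.sub (Int.modEq_zero_iff_dvd.2 dvd_rfl)
  rw [semigroupIndicator_eq_ite hpq hj hjp hjz, semigroupIndicator_eq_ite hpq hj hjp hz']
  lift j to ℕ using hj
  rw [Finset.sum_eq_single_of_mem j (Finset.mem_range.2 (by lia))]
  · have hgap : (j : ℤ) * q < z → (j : ℤ) * q ≤ z - p := fun hlt => by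
      linarith [Int.le_of_dvd (sub_pos.2 hlt) hjz.symm.dvd]
    grind
  · rintro i hi hij
    refine if_neg fun hz => hij ?_
    have hmod := modEq_of_mul_modEq_mul_right hpq hp (hz ▸ hjz)
    exact (Int.natCast_modEq_iff.1 hmod).eq_of_lt_of_lt (Finset.mem_range.1 hi) (by lia)

end Semigroup

section Kaplan

theorem coeff_eq_of_mul_X_pow_sub_one {R : Type*} [Ring R] {f g : R[X]} {m : ℕ} (hm : 0 < m)
    (h : f * (X ^ m - 1) = g) {F : ℤ → R} (hF : ∀ z < 0, F z = 0)
    (hFg : ∀ n : ℕ, F (n - m) - F n = g.coeff n) (n : ℕ) : f.coeff n = F n := by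
  induction n using Nat.strong_induction_on with
  | _ n ih =>
    have hcoeff := hFg n
    rw [← h, mul_sub_one, coeff_sub, coeff_mul_X_pow'] at hcoeff
    split_ifs at hcoeff with hmn
    · rw [ih (n - m) (by lia), Nat.cast_sub hmn] at hcoeff
      exact (sub_right_injective hcoeff).symm
    · rw [hF _ (by lia)] at hcoeff
      exact (sub_right_injective hcoeff).symm

/-- The coefficient of `X ^ z` in the power series `f(X ^ r) * X ^ d / (1 - X ^ N)`, where
`deg f < N`, `d < N` and `u` is inverse to `r` modulo `N`: at most one term of `f(X ^ r) * X ^ d`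
of degree at most `z` has degree congruent to `z` modulo `N`. -/
noncomputable def geomSeriesCoeff {R : Type*} [Semiring R] (f : R[X]) (N r : ℕ) (u : ℤ) (d : ℕ)
    (z : ℤ) : R :=
  if u * (z - d) % N ≤ z / r then f.coeff (u * (z - d) % N).toNat else 0

theorem geomSeriesCoeff_of_neg {R : Type*} [Semiring R] (f : R[X]) {N r : ℕ} (hN : 0 < N)
    (hr : 0 < r) (u : ℤ) (d : ℕ) {z : ℤ} (hz : z < 0) : geomSeriesCoeff f N r u d z = 0 := by
  refine if_neg (not_le.2 ?_)
  calc z / r < 0 := Int.ediv_neg_of_neg_of_pos hz (by lia)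
    _ ≤ u * (z - d) % N := Int.emod_nonneg _ (by lia)

theorem coeff_expand_mul_X_pow_eq_ite {R : Type*} [CommSemiring R] {f : R[X]} {N r d : ℕ}
    (hr : 0 < r) (hf : f.natDegree < N) (hd : d < N) {u : ℤ} (hu : r * u ≡ 1 [ZMOD N]) {n i : ℕ}
    (hi : i < N) (hin : i ≡ u * (n - d) [ZMOD N]) :
    (expand R r f * X ^ d).coeff n = if r * i ≤ n ∧ n < r * i + N then f.coeff i else 0 := by
  have hri : (r * i : ℤ) ≡ n - d [ZMOD N] := by
    calc (r * i : ℤ) ≡ r * (u * (n - d)) [ZMOD N] := hin.mul_left _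
      _ = r * u * (n - d) := by ring
      _ ≡ 1 * (n - d) [ZMOD N] := hu.mul_right _
      _ = n - d := one_mul _
  have hiff : r * i ≤ n ∧ n < r * i + N ↔ r * i + d = n := by
    refine ⟨fun h => ?_, by lia⟩
    have := Int.eq_zero_of_abs_lt_dvd hri.dvd (by rw [abs_lt]; constructor <;> lia)
    lia
  simp only [hiff]
  rw [coeff_mul_X_pow', coeff_expand hr]
  split_ifs with hdn hrn h h h
  · rw [← h, Nat.add_sub_cancel, Nat.mul_div_cancel_left i hr]
  · obtain ⟨k, hk⟩ := hrn
    rw [hk, Nat.mul_div_cancel_left k hr]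
    refine coeff_eq_zero_of_natDegree_lt (hf.trans_le (not_lt.1 fun hkN => h ?_))
    have hik : (i : ℤ) ≡ k [ZMOD N] := by
      calc (i : ℤ) ≡ u * (n - d) [ZMOD N] := hin
        _ = r * u * k := by rw [← Nat.cast_sub hdn, hk]; push_cast; ring
        _ ≡ 1 * k [ZMOD N] := hu.mul_right _
        _ = k := one_mul _
    rw [(Int.natCast_modEq_iff.1 hik).eq_of_lt_of_lt hi hkN]
    lia
  · exact absurd (Dvd.intro i (by lia)) hrn
  all_goals lia

theorem geomSeriesCoeff_sub {R : Type*} [CommRing R] {f : R[X]} {N r d : ℕ} (hr : 0 < r)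
    (hf : f.natDegree < N) (hd : d < N) {u : ℤ} (hu : r * u ≡ 1 [ZMOD N]) (n : ℕ) :
    geomSeriesCoeff f N r u d n - geomSeriesCoeff f N r u d (n - N) =
      (expand R r f * X ^ d).coeff n := by
  have hN : (0 : ℤ) < N := by lia
  obtain ⟨i, hi, hin⟩ := Int.existsUnique_equiv_nat (u * (n - d)) hN
  have hres : u * (n - d) % N = i := hin.symm.eq.trans (Int.emod_eq_of_lt (by lia) hi)
  have hres' : u * (n - N - d) % N = i := by
    rw [← hres, show u * ((n : ℤ) - N - d) = u * (n - d) - N * u by ring,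
      Int.sub_mul_emod_self_left]
  have hle (m : ℤ) : (i : ℤ) ≤ m / r ↔ (r * i : ℤ) ≤ m := by
    rw [Int.le_ediv_iff_mul_le (by lia), mul_comm]
  rw [coeff_expand_mul_X_pow_eq_ite hr hf hd hu (by lia) hin]
  simp only [geomSeriesCoeff, hres, hres', hle, Int.toNat_natCast]
  grind

variable {p q r : ℕ}

theorem cyclotomic_mul_prime_mul_cyclotomic (hp : p.Prime) (hq : q.Prime) (hpq : p ≠ q) :
    cyclotomic (p * q) ℤ * cyclotomic p ℤ = ∑ j ∈ Finset.range p, X ^ (j * q) := by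
  have : Fact p.Prime := ⟨hp⟩
  have hqp : ¬q ∣ p := fun h => hpq ((Nat.prime_dvd_prime_iff_eq hq hp).1 h).symm
  rw [← cyclotomic_expand_eq_cyclotomic_mul hq hqp, cyclotomic_prime, map_sum]
  refine Finset.sum_congr rfl fun j _ => ?_
  rw [map_pow, expand_X, ← pow_mul, mul_comm]

theorem cyclotomic_mul_prime_mul_X_pow_sub_one (hp : p.Prime) (hq : q.Prime) (hpq : p ≠ q) :
    cyclotomic (p * q) ℤ * (X ^ p - 1) = (∑ j ∈ Finset.range p, X ^ (j * q)) * (X - 1) := by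
  have : Fact p.Prime := ⟨hp⟩
  rw [← cyclotomic_mul_prime_mul_cyclotomic hp hq hpq, mul_assoc,
    cyclotomic_prime_mul_X_sub_one ℤ p]

theorem coeff_cyclotomic_mul_prime (hp : p.Prime) (hq : q.Prime) (hpq : p ≠ q) (n : ℕ) :
    (cyclotomic (p * q) ℤ).coeff n = binaryCoeff p q n := by
  have hcop : p.Coprime q := (Nat.coprime_primes hp hq).2 hpq
  refine coeff_eq_of_mul_X_pow_sub_one hp.pos
    (cyclotomic_mul_prime_mul_X_pow_sub_one hp hq hpq) (fun z => binaryCoeff_of_neg) (fun n => ?_) n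
  have hsum (m : ℕ) : (∑ j ∈ Finset.range p, (X : ℤ[X]) ^ (j * q)).coeff m =
      semigroupIndicator p q m - semigroupIndicator p q (m - p) := by
    rw [semigroupIndicator_sub hcop hp.pos, finsetSum_coeff]
    simp only [coeff_X_pow]
    norm_cast
  rw [mul_sub_one, coeff_sub, hsum, binaryCoeff, binaryCoeff]
  cases n with
  | zero =>
    rw [coeff_mul_X_zero, semigroupIndicator_of_neg (z := (0 : ℕ) - p) (by grind [hp.pos]),
      semigroupIndicator_of_neg (z := (0 : ℕ) - p - 1) (by lia),
      semigroupIndicator_of_neg (z := (0 : ℕ) - 1) (by lia)]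
    ring
  | succ n =>
    rw [coeff_mul_X, hsum, show ((n + 1 : ℕ) : ℤ) - p - 1 = n - p by lia,
      show ((n + 1 : ℕ) : ℤ) - 1 = n by lia]
    ring

theorem cyclotomic_ternary_mul_X_pow_sub_one (hp : p.Prime) (hq : q.Prime) (hpq : p ≠ q)
    (hr : r.Prime) (hrn : ¬r ∣ p * q) :
    cyclotomic (p * q * r) ℤ * (X ^ (p * q) - 1) =
      expand ℤ r (cyclotomic (p * q) ℤ) * (cyclotomic p ℤ * (X ^ q - 1)) := by
  have hgeom : (∑ j ∈ Finset.range p, (X : ℤ[X]) ^ (j * q)) * (X ^ q - 1) = X ^ (p * q) - 1 := by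
    simpa only [← pow_mul, mul_comm] using geom_sum_mul ((X : ℤ[X]) ^ q) p
  rw [cyclotomic_expand_eq_cyclotomic_mul hr hrn, ← hgeom,
    ← cyclotomic_mul_prime_mul_cyclotomic hp hq hpq]
  ring

theorem coeff_cyclotomic_ternary (hp : p.Prime) (hq : q.Prime) (hpq : p ≠ q) (hr : r.Prime)
    (hrn : ¬r ∣ p * q) {u : ℤ} (hu : r * u ≡ 1 [ZMOD (p * q : ℕ)]) (n : ℕ) :
    (cyclotomic (p * q * r) ℤ).coeff n = ∑ m ∈ Finset.range p,
      (geomSeriesCoeff (cyclotomic (p * q) ℤ) (p * q) r u m n -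
        geomSeriesCoeff (cyclotomic (p * q) ℤ) (p * q) r u (q + m) n) := by
  have : Fact p.Prime := ⟨hp⟩
  have hpq0 : 0 < p * q := mul_pos hp.pos hq.pos
  have hdeg : (cyclotomic (p * q) ℤ).natDegree < p * q := by
    rw [natDegree_cyclotomic]
    exact Nat.totient_lt _ (by nlinarith [hp.two_le, hq.two_le])
  have hwindow : cyclotomic p ℤ * (X ^ q - 1) = ∑ m ∈ Finset.range p, (X ^ (q + m) - X ^ m) := by
    rw [cyclotomic_prime, Finset.sum_mul]
    exact Finset.sum_congr rfl fun m _ => by ring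
  refine coeff_eq_of_mul_X_pow_sub_one hpq0 (cyclotomic_ternary_mul_X_pow_sub_one hp hq hpq hr hrn)
    (F := fun z => ∑ m ∈ Finset.range p,
      (geomSeriesCoeff (cyclotomic (p * q) ℤ) (p * q) r u m z -
        geomSeriesCoeff (cyclotomic (p * q) ℤ) (p * q) r u (q + m) z))
    (fun z hz => by simp [geomSeriesCoeff_of_neg _ hpq0 hr.pos u _ hz]) (fun n => ?_) n
  rw [← Finset.sum_sub_distrib, hwindow, Finset.mul_sum, finsetSum_coeff]
  refine Finset.sum_congr rfl fun m hm => ?_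
  have hm' : q + m < p * q := by nlinarith [Finset.mem_range.1 hm, hp.two_le, hq.two_le]
  rw [mul_sub, coeff_sub, ← geomSeriesCoeff_sub hr.pos hdeg hm' hu,
    ← geomSeriesCoeff_sub hr.pos hdeg (by lia) hu]
  ring

end Kaplan

section Windows

/-- The sum of the coefficients of `Φ_{pq}` of degree at most `K` over the window
`N, N - u, …, N - u (p - 1)` of exponents. -/
noncomputable def windowSum (p q : ℕ) (u K N : ℤ) : ℤ :=
  ∑ m ∈ Finset.range p, if N - u * m ≤ K then binaryCoeff p q (N - u * m) else 0

/-- The sum of the coefficients of `Φ_{pq}` over the exponents `x, x + u, …, x + u (M - 1)`. -/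
noncomputable def progressionSum (p q : ℕ) (u x : ℤ) (M : ℕ) : ℤ :=
  ∑ i ∈ Finset.range M, binaryCoeff p q (x + u * i)

/-- Primes `p`, `q`, `r` for which Kaplan's description of the coefficients of `Φ_{pqr}` has no
wrap-around: `u` is an inverse of `r` modulo `pq`, so small that a progression of length `p` and
difference `u` is shorter than `q`. -/
structure ShortInverse (p q r : ℕ) (u : ℤ) : Prop where
  prime_p : p.Prime
  prime_q : q.Prime
  prime_r : r.Prime
  mul_lt_r : p * q < r
  inverse : r * u ≡ 1 [ZMOD (p * q : ℕ)]
  pos : 0 < u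
  mul_lt_q : u * p < q

variable {p q r : ℕ} {u : ℤ}

theorem progressionSum_add (x : ℤ) (M L : ℕ) :
    progressionSum p q u x (M + L) =
      progressionSum p q u x M + progressionSum p q u (x + u * M) L := by
  simp only [progressionSum, Finset.sum_range_add, Nat.cast_add, mul_add, add_assoc]

theorem exists_forall_add_mul_le_iff (hu : 0 < u) (x K : ℤ) (p : ℕ) :
    ∃ M ≤ p, ∀ i < p, x + u * i ≤ K ↔ i < M := by
  refine ⟨min p ((K - x) / u + 1).toNat, min_le_left _ _, fun i hi => ?_⟩
  rw [lt_min_iff, and_iff_right hi, Int.lt_toNat, Int.lt_add_one_iff, Int.le_ediv_iff_mul_le hu,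
    mul_comm, le_sub_iff_add_le']

theorem windowSum_eq_progressionSum {K N : ℤ} {M : ℕ} (hM : M ≤ p)
    (h : ∀ i < p, N - u * (p - 1) + u * i ≤ K ↔ i < M) :
    windowSum p q u K N = progressionSum p q u (N - u * (p - 1)) M := by
  have hterm : ∀ i ∈ Finset.range p,
      (if N - u * (p - 1 - i : ℕ) ≤ K then binaryCoeff p q (N - u * (p - 1 - i : ℕ)) else 0) =
        if i < M then binaryCoeff p q (N - u * (p - 1) + u * i) else 0 := by
    intro i hi
    have hi' := Finset.mem_range.1 hi
    have hreflect : N - u * (p - 1 - i : ℕ) = N - u * (p - 1) + u * i := by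
      rw [show ((p - 1 - i : ℕ) : ℤ) = p - 1 - i by lia]
      ring
    simp only [hreflect, h i hi']
  have hfilter : {i ∈ Finset.range p | i < M} = Finset.range M := by
    ext i
    simp only [Finset.mem_filter, Finset.mem_range]
    lia
  rw [windowSum, ← Finset.sum_range_reflect, Finset.sum_congr rfl hterm, ← Finset.sum_filter,
    hfilter, progressionSum]

theorem windowSum_of_le (hu : 0 ≤ u) {K N : ℤ} (h : N ≤ K) :
    windowSum p q u K N = progressionSum p q u (N - u * (p - 1)) p := by
  refine windowSum_eq_progressionSum le_rfl fun i hi => iff_of_true ?_ hi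
  nlinarith

theorem windowSum_of_lt (hu : 0 ≤ u) {K N : ℤ} (h : K < N - u * (p - 1)) :
    windowSum p q u K N = 0 := by
  rw [windowSum_eq_progressionSum (Nat.zero_le p) fun i _ => iff_of_false ?_ i.not_lt_zero]
  · exact Finset.sum_range_zero _
  · nlinarith

theorem geomSeriesCoeff_cyclotomic_mul_prime (hp : p.Prime) (hq : q.Prime) (hpq : p ≠ q) {d : ℕ}
    {y z : ℤ} (hy : y ≡ u * (z - d) [ZMOD (p * q : ℕ)]) (hqy : -(q : ℤ) ≤ y) (hypq : y < p * q) :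
    geomSeriesCoeff (cyclotomic (p * q) ℤ) (p * q) r u d z =
      if y ≤ z / r then binaryCoeff p q y else 0 := by
  have hp2 : (2 : ℤ) ≤ p := by exact_mod_cast hp.two_le
  rw [geomSeriesCoeff, ← hy.eq]
  push_cast
  rcases le_or_gt 0 y with hy0 | hy0
  · rw [Int.emod_eq_of_lt hy0 hypq, coeff_cyclotomic_mul_prime hp hq hpq, Int.toNat_of_nonneg hy0]
  · have hmod : y % (p * q) = y + p * q := by
      rw [← Int.add_emod_right, Int.emod_eq_of_lt (by nlinarith) (by lia)]
    rw [hmod, coeff_cyclotomic_mul_prime hp hq hpq, Int.toNat_of_nonneg (by nlinarith),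
      binaryCoeff_of_neg hy0, binaryCoeff_of_frobenius_lt ((Nat.coprime_primes hp hq).2 hpq) hp.pos
      (by linarith), ite_self, ite_self]

namespace ShortInverse

theorem p_ne_q (S : ShortInverse p q r u) : p ≠ q := by
  nlinarith [S.pos, S.mul_lt_q]

theorem mul_sub_one_lt (S : ShortInverse p q r u) : u * (p - 1) < q := by
  linarith [S.pos, S.mul_lt_q]

theorem sum_geomSeriesCoeff (S : ShortInverse p q r u) (d : ℕ) (z : ℤ) :
    ∑ m ∈ Finset.range p, geomSeriesCoeff (cyclotomic (p * q) ℤ) (p * q) r u (d + m) z =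
      windowSum p q u (z / r) (u * (z - d) % (p * q : ℕ)) := by
  have hpq : (0 : ℤ) < (p * q : ℕ) := by exact_mod_cast mul_pos S.prime_p.pos S.prime_q.pos
  refine Finset.sum_congr rfl fun m hm => ?_
  have hN0 := Int.emod_nonneg (u * (z - d)) hpq.ne'
  have hN := Int.emod_lt_of_pos (u * (z - d)) hpq
  have hum : u * m ≤ u * (p - 1) := mul_le_mul_of_nonneg_left (by grind) S.pos.le
  have hum0 : 0 ≤ u * m := mul_nonneg S.pos.le m.cast_nonneg
  refine geomSeriesCoeff_cyclotomic_mul_prime S.prime_p S.prime_q S.p_ne_q ?_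
    (by linarith [S.mul_sub_one_lt]) (by push_cast at hN ⊢; linarith)
  calc u * (z - d) % (p * q : ℕ) - u * m ≡ u * (z - d) - u * m [ZMOD (p * q : ℕ)] :=
      (Int.mod_modEq _ _).sub_right _
    _ = u * (z - (d + m : ℕ)) := by push_cast; ring

theorem coeff_eq_windowSum_sub (S : ShortInverse p q r u) (n : ℕ) :
    (cyclotomic (p * q * r) ℤ).coeff n =
      windowSum p q u (n / r) (u * n % (p * q : ℕ)) -
        windowSum p q u (n / r) (u * (n - q) % (p * q : ℕ)) := by
  have hrn : ¬r ∣ p * q :=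
    Nat.not_dvd_of_pos_of_lt (mul_pos S.prime_p.pos S.prime_q.pos) S.mul_lt_r
  rw [coeff_cyclotomic_ternary S.prime_p S.prime_q S.p_ne_q S.prime_r hrn S.inverse,
    Finset.sum_sub_distrib, S.sum_geomSeriesCoeff q]
  simpa using S.sum_geomSeriesCoeff 0 n

theorem exists_div_eq_and_mul_modEq (S : ShortInverse p q r u) {K : ℤ} (hK : 0 ≤ K) (N : ℤ) :
    ∃ n : ℕ, (n / r : ℤ) = K ∧ u * n ≡ N [ZMOD (p * q : ℕ)] := by
  have hpq : (0 : ℤ) < (p * q : ℕ) := by exact_mod_cast mul_pos S.prime_p.pos S.prime_q.pos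
  obtain ⟨s, hs0, hs, hsN⟩ := Int.existsUnique_equiv (r * (N - K)) hpq
  have hr : (0 : ℤ) < r := by exact_mod_cast S.prime_r.pos
  have hsr : s < r := hs.trans (by exact_mod_cast S.mul_lt_r)
  obtain ⟨n, hn⟩ := Int.eq_ofNat_of_zero_le (add_nonneg hs0 (mul_nonneg hK hr.le))
  refine ⟨n, ?_, ?_⟩
  · rw [← hn, Int.add_mul_ediv_right _ _ hr.ne', Int.ediv_eq_zero_of_lt hs0 hsr, zero_add]
  · calc u * n = u * s + r * u * K := by rw [← hn]; ring
      _ ≡ u * (r * (N - K)) + r * u * K [ZMOD (p * q : ℕ)] := (hsN.mul_left u).add_right _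
      _ = r * u * N := by ring
      _ ≡ 1 * N [ZMOD (p * q : ℕ)] := S.inverse.mul_right N
      _ = N := one_mul N

theorem not_dvd (S : ShortInverse p q r u) : ¬(p : ℤ) ∣ u := fun h => by
  have hinv : r * u ≡ 1 [ZMOD p] := S.inverse.of_dvd (by simp)
  exact (Nat.prime_iff_prime_int.1 S.prime_p).not_dvd_one
    ((Int.ModEq.dvd_iff hinv).1 (h.mul_left _))

/-- The two windows in Kaplan's formula lie `u * q` apart modulo `p * q`; hence they are `w * q`
apart, in an order that decides the sign `σ`. -/
theorem exists_coeff_eq_mul_windowSum_sub (S : ShortInverse p q r u) (n : ℕ) :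
    ∃ (σ : ℤˣ) (w N : ℤ), w ≡ -σ * u [ZMOD p] ∧ 0 < w ∧ w < p ∧ 0 ≤ N ∧ N + w * q < p * q ∧
      (cyclotomic (p * q * r) ℤ).coeff n =
        σ * (windowSum p q u (n / r) N - windowSum p q u (n / r) (N + w * q)) := by
  have hpq : (0 : ℤ) < (p * q : ℕ) := by exact_mod_cast mul_pos S.prime_p.pos S.prime_q.pos
  rw [S.coeff_eq_windowSum_sub n]
  set A := u * n % (p * q : ℕ)
  set B := u * (n - q) % (p * q : ℕ)
  have hA0 : 0 ≤ A := Int.emod_nonneg _ hpq.ne'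
  have hB0 : 0 ≤ B := Int.emod_nonneg _ hpq.ne'
  have hA1 : A < p * q := (Int.emod_lt_of_pos _ hpq).trans_eq (Nat.cast_mul p q)
  have hB1 : B < p * q := (Int.emod_lt_of_pos _ hpq).trans_eq (Nat.cast_mul p q)
  obtain ⟨k, hk⟩ : ((p * q : ℕ) : ℤ) ∣ u * q - (A - B) := by
    refine Int.ModEq.dvd ?_
    calc A - B ≡ u * n - u * (n - q) [ZMOD (p * q : ℕ)] :=
        (Int.mod_modEq _ _).sub (Int.mod_modEq _ _)
      _ = u * q := by ring
  obtain ⟨c, hc⟩ : ∃ c : ℤ, c = u - p * k := ⟨_, rfl⟩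
  have hAB : A = B + c * q := by rw [hc]; push_cast at hk; linarith
  have hcu : c ≡ u [ZMOD p] := by rw [hc]; simp
  rcases lt_trichotomy c 0 with hc0 | rfl | hc0
  · refine ⟨1, -c, A, by simpa using hcu.neg, by lia, by nlinarith, hA0, by linarith, ?_⟩
    rw [show A + -c * q = B by linarith]
    simp
  · exact absurd (Int.modEq_zero_iff_dvd.1 hcu.symm) S.not_dvd
  · refine ⟨-1, c, B, by simpa using hcu, hc0, by nlinarith, hB0, by linarith, ?_⟩
    rw [← hAB]
    simp

theorem exists_coeff_eq_of_windows (S : ShortInverse p q r u) {σ : ℤˣ} {w : ℤ}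
    (hw : w ≡ -σ * u [ZMOD p]) (hw0 : 0 < w) {K N : ℤ} (hK : 0 ≤ K) (hN : 0 ≤ N)
    (hNw : N + w * q < p * q) :
    ∃ n : ℕ, (n / r : ℤ) = K ∧ (cyclotomic (p * q * r) ℤ).coeff n =
      σ * (windowSum p q u K N - windowSum p q u K (N + w * q)) := by
  have hwq : w * q ≡ -σ * u * q [ZMOD (p * q : ℕ)] := by
    push_cast
    exact hw.mul_right'
  have hq : 0 ≤ w * q := by positivity
  have hemod {y T : ℤ} (hT0 : 0 ≤ T) (hT : T < p * q) (h : y ≡ T [ZMOD (p * q : ℕ)]) :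
      y % (p * q : ℕ) = T := h.eq.trans (Int.emod_eq_of_lt hT0 (by exact_mod_cast hT))
  rcases Int.units_eq_one_or σ with rfl | rfl
  · obtain ⟨n, hn, hnN⟩ := S.exists_div_eq_and_mul_modEq hK N
    refine ⟨n, hn, ?_⟩
    have hnN' : u * (n - q) ≡ N + w * q [ZMOD (p * q : ℕ)] := by
      rw [mul_sub]
      simpa [sub_eq_add_neg] using hnN.add hwq.symm
    rw [S.coeff_eq_windowSum_sub, hn, hemod hN (by linarith) hnN, hemod (by linarith) hNw hnN']
    simp
  · obtain ⟨n, hn, hnN⟩ := S.exists_div_eq_and_mul_modEq hK (N + w * q)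
    refine ⟨n, hn, ?_⟩
    have hnN' : u * (n - q) ≡ N [ZMOD (p * q : ℕ)] := by
      simpa [mul_sub] using hnN.sub hwq.symm
    rw [S.coeff_eq_windowSum_sub, hn, hemod hN (by linarith) hnN', hemod (by linarith) hNw hnN]
    simp

/-- For `K` beyond the degree of `Φ_{pqr}` the coefficient in `exists_coeff_eq_of_windows`
vanishes. -/
theorem progressionSum_window_eq (S : ShortInverse p q r u) {σ : ℤˣ} {w : ℤ}
    (hw : w ≡ -σ * u [ZMOD p]) (hw0 : 0 < w) {N : ℤ} (hN : 0 ≤ N) (hNw : N + w * q < p * q) :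
    progressionSum p q u (N - u * (p - 1)) p =
      progressionSum p q u (N + w * q - u * (p - 1)) p := by
  have hpq : p * q ≤ p * q * r := Nat.le_mul_of_pos_right _ S.prime_r.pos
  have hp : p ≤ p * q := Nat.le_mul_of_pos_right _ S.prime_q.pos
  obtain ⟨n, hn, hcoeff⟩ := S.exists_coeff_eq_of_windows hw hw0
    (K := ((p * q * r : ℕ) : ℤ)) (by positivity) hN hNw
  have hdeg : (cyclotomic (p * q * r) ℤ).natDegree < n := by
    rw [natDegree_cyclotomic]
    have hn' : n / r = p * q * r := by exact_mod_cast hn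
    calc (p * q * r).totient < p * q * r := Nat.totient_lt _ (by linarith [S.prime_p.one_lt])
      _ ≤ n := hn' ▸ Nat.div_le_self n r
  have hK : N + w * q ≤ (p * q * r : ℕ) := hNw.le.trans (by exact_mod_cast hpq)
  rw [coeff_eq_zero_of_natDegree_lt hdeg, windowSum_of_le S.pos.le hK,
    windowSum_of_le S.pos.le (by nlinarith), eq_comm, mul_eq_zero,
    or_iff_right (Units.ne_zero σ), sub_eq_zero] at hcoeff
  exact hcoeff

/-- Both windows are cut off at the same bound and are disjoint, so only one of them is cut
properly; its lower or upper part is the progression. -/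
theorem exists_coeff_eq_mul_progressionSum (S : ShortInverse p q r u) (n : ℕ) :
    ∃ (σ : ℤˣ) (w x : ℤ) (M : ℕ), w ≡ -σ * u [ZMOD p] ∧ 0 < w ∧ w < p ∧ M ≤ p ∧
      (x + u * (M - 1) < (p - w) * q ∨ (w - 1) * q < x) ∧
      (cyclotomic (p * q * r) ℤ).coeff n = σ * progressionSum p q u x M := by
  obtain ⟨σ, w, N, hw, hw0, hwp, hN, hNw, hcoeff⟩ := S.exists_coeff_eq_mul_windowSum_sub n
  have hfull := S.progressionSum_window_eq hw hw0 hN hNw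
  have hshort := S.mul_sub_one_lt
  have hu := S.pos
  rw [hcoeff]
  rcases lt_or_ge (n / r : ℤ) (N + w * q - u * (p - 1)) with hK | hK
  · obtain ⟨M, hM, hiff⟩ := exists_forall_add_mul_le_iff hu (N - u * (p - 1)) (n / r) p
    refine ⟨σ, w, N - u * (p - 1), M, hw, hw0, hwp, hM, Or.inl ?_, ?_⟩
    · nlinarith
    · rw [windowSum_eq_progressionSum hM hiff, windowSum_of_lt hu.le hK, sub_zero]
  · obtain ⟨M, hM, hiff⟩ := exists_forall_add_mul_le_iff hu (N + w * q - u * (p - 1)) (n / r) p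
    refine ⟨σ, w, N + w * q - u * (p - 1) + u * M, p - M, hw, hw0, hwp, Nat.sub_le p M,
      Or.inr ?_, ?_⟩
    · nlinarith
    · have hsplit :=
        progressionSum_add (p := p) (q := q) (u := u) (N + w * q - u * (p - 1)) M (p - M)
      rw [Nat.add_sub_cancel' hM] at hsplit
      rw [windowSum_of_le hu.le (by nlinarith), windowSum_eq_progressionSum hM hiff, hfull, hsplit,
        add_sub_cancel_left]

theorem exists_coeff_eq_of_progression (S : ShortInverse p q r u) {σ : ℤˣ} {w : ℤ}
    (hw : w ≡ -σ * u [ZMOD p]) (hw0 : 0 < w) {x : ℤ} {M : ℕ} (hx : 0 < x) (hM : M ≤ p)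
    (hwx : w * q ≤ x + u * (M - 1)) (hxpq : x + u * (M - 1) < p * q) :
    ∃ n, (cyclotomic (p * q * r) ℤ).coeff n = σ * progressionSum p q u x M := by
  have hu := S.pos
  have hshort := S.mul_sub_one_lt
  obtain ⟨N, hN⟩ : ∃ N, N + w * q = x + u * (M - 1) := ⟨_, sub_add_cancel _ _⟩
  obtain ⟨n, -, hcoeff⟩ := S.exists_coeff_eq_of_windows hw hw0 (K := x - 1) (N := N) (by lia)
    (by linarith) (by linarith)
  have hfull := S.progressionSum_window_eq hw hw0 (N := N) (by linarith) (by linarith)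
  refine ⟨n, ?_⟩
  have hM' : ((p - M : ℕ) : ℤ) = p - M := Nat.cast_sub hM
  have hNx : N ≤ x - 1 := by nlinarith
  have hsplit := progressionSum_add (p := p) (q := q) (u := u) (N + w * q - u * (p - 1)) (p - M) M
  rw [Nat.sub_add_cancel hM, show N + w * q - u * (p - 1) + u * (p - M : ℕ) = x by
    rw [hN, hM']; ring] at hsplit
  have hcut : windowSum p q u (x - 1) (N + w * q) =
      progressionSum p q u (N + w * q - u * (p - 1)) (p - M) := by
    refine windowSum_eq_progressionSum (Nat.sub_le p M) fun i _ => ⟨fun h => ?_, fun h => ?_⟩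
    · have hlt : u * (i : ℤ) < u * (p - M : ℕ) := by rw [hM']; linarith
      exact_mod_cast lt_of_mul_lt_mul_left hlt hu.le
    · have hle : u * ((i : ℤ) + 1) ≤ u * (p - M : ℕ) := by gcongr; lia
      rw [hM'] at hle
      linarith
  rw [hcoeff, windowSum_of_le hu.le hNx, hcut, hfull, hsplit, add_sub_cancel_left]

end ShortInverse

end Windows

section Bounds

/-- A step `u` with inverse `e` modulo `p` such that `q ≡ η * u` modulo `p`. Thus moving by `u`
shifts the residue class of `j * q` by `η`, moving by `1` shifts it by `η * e`, and a progression of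
length `p` and difference `u` is shorter than `q`. -/
structure StepInverse (p q : ℕ) (u : ℤ) (e : ℕ) (η : ℤˣ) : Prop where
  one_le : 1 ≤ e
  two_mul_lt : 2 * e < p
  lt_u : p < u
  mul_lt_q : u * p < q
  inverse : u * e ≡ 1 [ZMOD p]
  modEq : q ≡ η * u [ZMOD p]

variable {p q : ℕ} {u : ℤ} {e : ℕ} {η : ℤˣ}

theorem progressionSum_add_eq_sub (e L : ℕ) (x : ℤ) :
    progressionSum p q u x (e + L) =
      ∑ i ∈ Finset.range e,
          (semigroupIndicator p q (x + u * (L + i)) - semigroupIndicator p q (x + u * i - 1)) -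
        ∑ i ∈ Finset.range L,
          (semigroupIndicator p q (x + u * (e + i) - 1) - semigroupIndicator p q (x + u * i)) := by
  have hhead := Finset.sum_range_add (fun i : ℕ => semigroupIndicator p q (x + u * i)) L e
  have hpred := Finset.sum_range_add (fun i : ℕ => semigroupIndicator p q (x + u * i - 1)) e L
  simp only [Nat.cast_add, add_comm L e] at hhead hpred
  simp only [progressionSum, binaryCoeff, Finset.sum_sub_distrib, hhead, hpred]
  ring

theorem abs_progressionSum_le (x : ℤ) (M : ℕ) : |progressionSum p q u x M| ≤ M := by
  calc |progressionSum p q u x M| ≤ ∑ i ∈ Finset.range M, |binaryCoeff p q (x + u * i)| :=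
      Finset.abs_sum_le_sum_abs _ _
    _ ≤ ∑ i ∈ Finset.range M, 1 := Finset.sum_le_sum fun i _ => abs_binaryCoeff_le_one p q _
    _ = M := by simp

theorem neg_le_sum_semigroupIndicator_sub (y z : ℕ → ℤ) (e : ℕ) :
    -(e : ℤ) ≤ ∑ i ∈ Finset.range e,
      (semigroupIndicator p q (y i) - semigroupIndicator p q (z i)) := by
  calc -(e : ℤ) = ∑ i ∈ Finset.range e, (-1 : ℤ) := by simp
    _ ≤ _ := Finset.sum_le_sum fun i _ => by
      linarith [semigroupIndicator_nonneg p q (y i), semigroupIndicator_le_one p q (z i)]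

namespace StepInverse

theorem p_pos (D : StepInverse p q u e η) : 0 < p := by
  linarith [D.two_mul_lt]

theorem u_pos (D : StepInverse p q u e η) : 0 < u := by
  linarith [D.lt_u, D.p_pos]

theorem coprime (D : StepInverse p q u e η) : p.Coprime q := by
  have hinv : q * (η * e) ≡ 1 [ZMOD p] := by
    calc q * (η * e) ≡ η * u * (η * e) [ZMOD p] := D.modEq.mul_right _
      _ = η * η * (u * e) := by ring
      _ = u * e := by rw [Int.units_coe_mul_self, one_mul]
      _ ≡ 1 [ZMOD p] := D.inverse
  obtain ⟨k, hk⟩ := hinv.dvd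
  exact Nat.isCoprime_iff_coprime.1 ⟨k, η * e, by linarith⟩

theorem sub_modEq (D : StepInverse p q u e η) {y z j k s t : ℤ} (hy : y ≡ j * q [ZMOD p])
    (hz : z ≡ k * q [ZMOD p]) (h : z - y = u * s + t) : k - j ≡ η * (s + t * e) [ZMOD p] := by
  have hη : (η : ℤ) * η = 1 := Int.units_coe_mul_self η
  calc k - j = (k - j) * 1 * (η * η) := by rw [hη]; ring
    _ ≡ (k - j) * (u * e) * (η * η) [ZMOD p] := ((D.inverse.symm.mul_left _).mul_right _)
    _ = (k - j) * (η * u) * (e * η) := by ring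
    _ ≡ (k - j) * q * (e * η) [ZMOD p] := (D.modEq.symm.mul_left _).mul_right _
    _ = (k * q - j * q) * (e * η) := by ring
    _ ≡ (z - y) * (e * η) [ZMOD p] := (hz.symm.sub hy.symm).mul_right _
    _ = η * (s * (u * e) + t * e) := by rw [h]; ring
    _ ≡ η * (s * 1 + t * e) [ZMOD p] := ((D.inverse.mul_left s).add_right _).mul_left _
    _ = η * (s + t * e) := by ring

theorem add_mul_modEq (D : StepInverse p q u e η) (x i : ℤ) :
    x + u * i ≡ x + u * (e + i) - 1 [ZMOD p] := by
  calc x + u * i = 1 + (x + u * i - 1) := by ring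
    _ ≡ u * e + (x + u * i - 1) [ZMOD p] := D.inverse.symm.add_right _
    _ = x + u * (e + i) - 1 := by ring

theorem semigroupIndicator_le_shift (D : StepInverse p q u e η) (x i : ℤ) :
    semigroupIndicator p q (x + u * i) ≤ semigroupIndicator p q (x + u * (e + i) - 1) := by
  refine semigroupIndicator_le_of_modEq D.p_pos ?_ (D.add_mul_modEq x i)
  have he : (1 : ℤ) ≤ e := by exact_mod_cast D.one_le
  nlinarith [D.u_pos]

theorem progressionSum_le (D : StepInverse p q u e η) (x : ℤ) (M : ℕ) :
    progressionSum p q u x M ≤ e := by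
  rcases le_total M e with hM | hM
  · exact (le_of_abs_le (abs_progressionSum_le x M)).trans (by exact_mod_cast hM)
  · obtain ⟨L, rfl⟩ := Nat.exists_eq_add_of_le hM
    rw [progressionSum_add_eq_sub]
    have hshift := Finset.sum_nonneg fun i (_ : i ∈ Finset.range L) =>
      sub_nonneg.2 (D.semigroupIndicator_le_shift x i)
    have hends := neg_le_sum_semigroupIndicator_sub (p := p) (q := q)
      (fun i => x + u * i - 1) (fun i => x + u * (L + i)) e
    rw [← neg_le_neg_iff, neg_neg, ← Finset.sum_neg_distrib] at hends
    simp only [neg_sub] at hends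
    linarith

theorem exists_jump (D : StepInverse p q u e η) {x : ℤ} {c : ℕ}
    (h : semigroupIndicator p q (x + u * (e + c) - 1) - semigroupIndicator p q (x + u * c) ≠ 0) :
    ∃ j : ℤ, 0 ≤ j ∧ j < p ∧ x + u * c ≡ j * q [ZMOD p] ∧ x + u * c < j * q ∧
      j * q ≤ x + u * (e + c) - 1 :=
  exists_modEq_mul_and_lt_of_semigroupIndicator_lt D.coprime D.p_pos (D.add_mul_modEq x c)
    ((D.semigroupIndicator_le_shift x c).lt_of_ne (sub_ne_zero.1 h).symm)

/-- Jumps happen at multiples of `q`, the range of the progression contains at most one of these,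
and the jumps at it for different indices would be in different residue classes. -/
theorem sum_shift_le_one (D : StepInverse p q u e η) (x : ℤ) {L : ℕ} (hL : e + L ≤ p) :
    ∑ i ∈ Finset.range L, (semigroupIndicator p q (x + u * (e + i) - 1) -
      semigroupIndicator p q (x + u * i)) ≤ 1 := by
  by_cases hall : ∀ i ∈ Finset.range L, semigroupIndicator p q (x + u * (e + i) - 1) -
      semigroupIndicator p q (x + u * i) = 0
  · rw [Finset.sum_eq_zero hall]
    exact zero_le_one
  push Not at hall
  obtain ⟨c, hc, hjump⟩ := hall
  have hu := D.u_pos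
  have hup := D.mul_lt_q
  have hrange {i : ℕ} (hi : i ∈ Finset.range L) : 0 ≤ u * i ∧ u * (e + i) ≤ u * p :=
    ⟨by positivity, mul_le_mul_of_nonneg_left (by grind) hu.le⟩
  obtain ⟨j, -, -, hj, hjlt, hjle⟩ := D.exists_jump hjump
  rw [Finset.sum_eq_single_of_mem c hc]
  · linarith [semigroupIndicator_nonneg p q (x + u * c),
      semigroupIndicator_le_one p q (x + u * (e + c) - 1)]
  intro d hd hdc
  by_contra hjump'
  obtain ⟨k, -, -, hk, hklt, hkle⟩ := D.exists_jump hjump'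
  obtain rfl : j = k := by
    have hq : (0 : ℤ) < q := by nlinarith
    have hjk : j < k + 1 := lt_of_mul_lt_mul_right (by linarith [hrange hc, hrange hd]) hq.le
    have hkj : k < j + 1 := lt_of_mul_lt_mul_right (by linarith [hrange hc, hrange hd]) hq.le
    lia
  have hcd : (c : ℤ) ≡ d [ZMOD p] := by
    have hmod := (D.sub_modEq hj hk (s := d - c) (t := 0) (by ring)).mul_left η
    rw [sub_self, mul_zero, ← mul_assoc, Int.units_coe_mul_self] at hmod
    exact Int.modEq_iff_dvd.2 (Int.modEq_zero_iff_dvd.1 (by simpa using hmod.symm))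
  exact hdc ((Int.natCast_modEq_iff.1 hcd).eq_of_lt_of_lt (by grind) (by grind)).symm

theorem neg_sub_one_le_progressionSum (D : StepInverse p q u e η) (x : ℤ) {M : ℕ} (hM : M ≤ p) :
    -(e : ℤ) - 1 ≤ progressionSum p q u x M := by
  rcases le_total M e with hMe | hMe
  · linarith [neg_le_of_abs_le (abs_progressionSum_le (p := p) (q := q) (u := u) x M),
      (Nat.cast_le (α := ℤ)).2 hMe]
  · obtain ⟨L, rfl⟩ := Nat.exists_eq_add_of_le hMe
    rw [progressionSum_add_eq_sub]
    have hends := neg_le_sum_semigroupIndicator_sub (p := p) (q := q)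
      (fun i => x + u * (L + i)) (fun i => x + u * i - 1) e
    linarith [D.sum_shift_le_one x hM]

theorem exists_jump_of_progressionSum_lt (D : StepInverse p q u e η) {x : ℤ} {M : ℕ}
    (hM : M ≤ p) (h : progressionSum p q u x M < -e) :
    ∃ c : ℕ, e + c < M ∧
      semigroupIndicator p q (x + u * (e + c) - 1) - semigroupIndicator p q (x + u * c) ≠ 0 ∧
      (∀ i < e, semigroupIndicator p q (x + u * i - 1) = 1) ∧
      semigroupIndicator p q (x + u * (M - 1)) = 0 := by
  have hMe : e ≤ M := by
    by_contra! hlt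
    linarith [neg_le_of_abs_le (abs_progressionSum_le (p := p) (q := q) (u := u) x M),
      (Nat.cast_lt (α := ℤ)).2 hlt]
  obtain ⟨L, rfl⟩ := Nat.exists_eq_add_of_le hMe
  rw [progressionSum_add_eq_sub] at h
  have hends := neg_le_sum_semigroupIndicator_sub (p := p) (q := q)
    (fun i => x + u * (L + i)) (fun i => x + u * i - 1) e
  have hshift := D.sum_shift_le_one x hM
  obtain ⟨c, hc, hjump⟩ : ∃ c ∈ Finset.range L, semigroupIndicator p q (x + u * (e + c) - 1) -
      semigroupIndicator p q (x + u * c) ≠ 0 :=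
    Finset.exists_ne_zero_of_sum_ne_zero fun h0 => by linarith
  have hterm : ∀ i ∈ Finset.range e, (-1 : ℤ) = semigroupIndicator p q (x + u * (L + i)) -
      semigroupIndicator p q (x + u * i - 1) := by
    refine (Finset.sum_eq_sum_iff_of_le fun i _ => ?_).1 ?_
    · linarith [semigroupIndicator_nonneg p q (x + u * (L + i)),
        semigroupIndicator_le_one p q (x + u * i - 1)]
    · rw [Finset.sum_const, Finset.card_range, nsmul_eq_mul]
      linarith
  have hends' : ∀ i < e, semigroupIndicator p q (x + u * i - 1) = 1 ∧
      semigroupIndicator p q (x + u * (L + i)) = 0 := fun i hi => by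
    have := hterm i (Finset.mem_range.2 hi)
    have := semigroupIndicator_nonneg p q (x + u * (L + i))
    have := semigroupIndicator_le_one p q (x + u * i - 1)
    lia
  refine ⟨c, by grind, hjump, fun i hi => (hends' i hi).1, ?_⟩
  have hlast := (hends' (e - 1) (Nat.sub_one_lt_of_lt D.one_le)).2
  rw [Nat.cast_sub D.one_le] at hlast
  convert hlast using 3
  push_cast
  ring

/-- The residue classes responsible for a sum below `-e`: `j` jumps between two terms, and `l` has
not been reached at the end. -/
theorem exists_classes_of_progressionSum_lt (D : StepInverse p q u e η) {x : ℤ} {M : ℕ}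
    (hM : M ≤ p) (h : progressionSum p q u x M < -e) :
    ∃ (c : ℕ) (j l : ℤ), e + c < M ∧ x + u * c < j * q ∧ j * q ≤ x + u * (e + c) - 1 ∧
      j < l ∧ l < p ∧ l - j ≡ η * (M - 1 - c) [ZMOD p] ∧
      ∀ i < e, ∃ k : ℤ, 0 ≤ k ∧ k * q ≤ x + u * i - 1 ∧ j - k ≡ η * (c - i + e) [ZMOD p] := by
  obtain ⟨c, hcM, hjump, hone, hzero⟩ := D.exists_jump_of_progressionSum_lt hM h
  obtain ⟨j, -, -, hj, hjlt, hjle⟩ := D.exists_jump hjump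
  obtain ⟨l, hl0, hlp, hl⟩ := exists_modEq_mul_of_coprime D.coprime D.p_pos (x + u * (M - 1))
  have hlgt : x + u * (M - 1) < l * q := by
    rw [semigroupIndicator_eq_ite D.coprime hl0 hlp hl] at hzero
    grind
  have hjl : j < l := by
    have hcM' : u * (e + c) ≤ u * (M - 1) := mul_le_mul_of_nonneg_left (by lia) D.u_pos.le
    exact lt_of_mul_lt_mul_right (by linarith) q.cast_nonneg
  refine ⟨c, j, l, hcM, hjlt, hjle, hjl, hlp, ?_, fun i hi => ?_⟩
  · simpa using D.sub_modEq hj hl (s := M - 1 - c) (t := 0) (by ring)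
  · obtain ⟨k, hk0, hkp, hk⟩ := exists_modEq_mul_of_coprime D.coprime D.p_pos (x + u * i - 1)
    have hki := hone i hi
    rw [semigroupIndicator_eq_ite D.coprime hk0 hkp hk] at hki
    refine ⟨k, hk0, by grind, ?_⟩
    simpa using D.sub_modEq hk hj (s := c - i) (t := 1) (by ring)

theorem neg_le_progressionSum (D : StepInverse p q u e (-1)) (x : ℤ) {M : ℕ} (hM : M ≤ p) :
    -(e : ℤ) ≤ progressionSum p q u x M := by
  by_contra! hlt
  obtain ⟨c, j, l, hcM, hjlt, -, hjl, hlp, hlj, hk⟩ :=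
    D.exists_classes_of_progressionSum_lt hM hlt
  have he := D.one_le
  have hep := D.two_mul_lt
  obtain ⟨k, hk0, hkle, hjk⟩ := hk (e - 1) (by lia)
  have hkj : k < j + 1 := by
    have hue : u * (e - 1 : ℕ) ≤ u * p :=
      mul_le_mul_of_nonneg_left (by lia) D.u_pos.le
    have hc : 0 ≤ u * c := mul_nonneg D.u_pos.le c.cast_nonneg
    exact lt_of_mul_lt_mul_right (by linarith [D.mul_lt_q]) q.cast_nonneg
  obtain ⟨a, ha⟩ := hjk.dvd
  obtain ⟨b, hb⟩ := hlj.dvd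
  rw [Nat.cast_sub he] at ha
  push_cast at ha hb
  have hjk_eq : j - k + (c + 1) - p = 0 :=
    Int.eq_zero_of_abs_lt_dvd (m := p) ⟨-a - 1, by linarith⟩ (by rw [abs_lt]; lia)
  have hlj_eq : l - j + (M - 1 - c) - p = 0 :=
    Int.eq_zero_of_abs_lt_dvd (m := p) ⟨-b - 1, by linarith⟩ (by rw [abs_lt]; lia)
  lia

theorem exists_mul_mem_of_progressionSum_lt (D : StepInverse p q u e 1) {x : ℤ} {M : ℕ}
    (hM : M ≤ p) (h : progressionSum p q u x M < -e) :
    ∃ j : ℤ, e ≤ j ∧ j + e < p ∧ x < j * q ∧ j * q < x + u * (M - 1) := by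
  obtain ⟨c, j, l, hcM, hjlt, hjle, hjl, hlp, hlj, hk⟩ :=
    D.exists_classes_of_progressionSum_lt hM h
  obtain ⟨k, hk0, hkle, hjk⟩ := hk 0 D.one_le
  have hc : 0 ≤ u * c := mul_nonneg D.u_pos.le c.cast_nonneg
  have hcM' : u * (e + c) ≤ u * (M - 1) := mul_le_mul_of_nonneg_left (by lia) D.u_pos.le
  simp only [Nat.cast_zero, mul_zero, add_zero, sub_zero, Units.val_one, one_mul] at hkle hjk hlj
  have hkj : k < j := lt_of_mul_lt_mul_right (by linarith) q.cast_nonneg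
  have hjk_eq := Int.eq_zero_of_abs_lt_dvd hjk.dvd (by rw [abs_lt]; lia)
  have hlj_eq := Int.eq_zero_of_abs_lt_dvd hlj.dvd (by rw [abs_lt]; lia)
  exact ⟨j, by lia, by lia, by linarith, by linarith⟩

end StepInverse

end Bounds

section Realization

variable {p q : ℕ} {u : ℤ} {e : ℕ} {η : ℤˣ}

theorem progressionSum_eq_mul {x ε : ℤ} {M : ℕ} (h : ∀ i < M, binaryCoeff p q (x + u * i) = ε) :
    progressionSum p q u x M = M * ε := by
  rw [progressionSum, Finset.sum_congr rfl fun i hi => h i (Finset.mem_range.1 hi)]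
  simp

namespace StepInverse

theorem add_mul_sub_modEq (D : StepInverse p q u e η) {x t i j s : ℤ} (hx : x ≡ t * q [ZMOD p])
    (hj : j ≡ t + η * (i - s * e) [ZMOD p]) : x + u * i - s ≡ j * q [ZMOD p] := by
  have hη : (η : ℤ) * η = 1 := Int.units_coe_mul_self η
  symm
  calc j * q ≡ (t + η * (i - s * e)) * q [ZMOD p] := hj.mul_right _
    _ = t * q + η * (i - s * e) * q := by ring
    _ ≡ x + η * (i - s * e) * (η * u) [ZMOD p] := hx.symm.add (D.modEq.mul_left _)
    _ = x + η * η * (u * i - s * (u * e)) := by ring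
    _ ≡ x + η * η * (u * i - s * 1) [ZMOD p] :=
      (((D.inverse.mul_left s).sub_left _).mul_left _).add_left _
    _ = x + u * i - s := by rw [hη]; ring

/-- Inside the block `[j * q, (j + 1) * q)` with `j = p - 1 - e` the indicator only depends on the
classes `k i` of the terms and `l i` of their predecessors. -/
theorem exists_progressionSum_eq_mul_of_classes (D : StepInverse p q u e η) (t ε : ℤ)
    (k l : ℕ → ℤ) (hk : ∀ i < e, 0 ≤ k i ∧ k i < p ∧ k i ≡ t + η * i [ZMOD p])
    (hl : ∀ i < e, 0 ≤ l i ∧ l i < p ∧ l i ≡ t + η * (i - e) [ZMOD p])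
    (hε : ∀ i < e, ((if k i ≤ p - 1 - e then 1 else 0) - if l i ≤ p - 1 - e then 1 else 0) = ε) :
    ∃ x : ℤ, (p - 1 - e) * q < x ∧ x + u * (e - 1) < p * q ∧ progressionSum p q u x e = e * ε := by
  have hp : (0 : ℤ) < p := by exact_mod_cast D.p_pos
  have hu := D.u_pos
  obtain ⟨a, ha0, ha, hat⟩ := Int.existsUnique_equiv (t * q - ((p - 1 - e) * q + 1)) hp
  obtain ⟨x, hx⟩ : ∃ x, x = (p - 1 - e) * q + 1 + a := ⟨_, rfl⟩
  have hxt : x ≡ t * q [ZMOD p] := by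
    rw [hx]
    simpa using hat.add_left ((p - 1 - e) * q + 1)
  have hend : x + u * e < (p - 1 - e + 1) * q := by
    have hue : u * (e + 1) ≤ u * p := mul_le_mul_of_nonneg_left (by linarith [D.two_mul_lt]) hu.le
    linarith [D.lt_u, D.mul_lt_q]
  refine ⟨x, by linarith, ?_, progressionSum_eq_mul fun i hi => ?_⟩
  · have : 0 ≤ (e : ℤ) * q := by positivity
    linarith
  obtain ⟨hk0, hkp, hkt⟩ := hk i hi
  obtain ⟨hl0, hlp, hlt⟩ := hl i hi
  have hi' : u * i ≤ u * e := by gcongr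
  have hi0 : 0 ≤ u * i := by positivity
  have hterm : x + u * i ≡ k i * q [ZMOD p] := by
    simpa using D.add_mul_sub_modEq hxt (s := 0) (by simpa using hkt)
  have hpred : x + u * i - 1 ≡ l i * q [ZMOD p] := D.add_mul_sub_modEq hxt (by simpa using hlt)
  rw [binaryCoeff,
    semigroupIndicator_eq_ite_of_mem_block D.coprime hk0 hkp hterm (J := p - 1 - e)
      (by linarith) (by linarith),
    semigroupIndicator_eq_ite_of_mem_block D.coprime hl0 hlp hpred (J := p - 1 - e)
      (by linarith) (by linarith), hε i hi]

theorem exists_progressionSum_eq_mul (D : StepInverse p q u e η) (ε : ℤˣ) :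
    ∃ x : ℤ, (p - 1 - e) * q < x ∧ x + u * (e - 1) < p * q ∧ progressionSum p q u x e = e * ε := by
  have hep := D.two_mul_lt
  rcases Int.units_eq_one_or η with rfl | rfl <;> rcases Int.units_eq_one_or ε with rfl | rfl
  · exact D.exists_progressionSum_eq_mul_of_classes 0 _ (fun i => i) (fun i => i + p - e)
      (fun i hi => ⟨by lia, by lia, by simp⟩)
      (fun i hi => ⟨by lia, by lia, Int.modEq_iff_dvd.2 ⟨-1, by push_cast; ring⟩⟩)
      fun i hi => by rw [if_pos (by lia), if_neg (by lia)]; rfl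
  · exact D.exists_progressionSum_eq_mul_of_classes (-e) _ (fun i => i + p - e)
      (fun i => i + p - 2 * e)
      (fun i hi => ⟨by lia, by lia, Int.modEq_iff_dvd.2 ⟨-1, by push_cast; ring⟩⟩)
      (fun i hi => ⟨by lia, by lia, Int.modEq_iff_dvd.2 ⟨-1, by push_cast; ring⟩⟩)
      fun i hi => by rw [if_neg (by lia), if_pos (by lia)]; rfl
  · exact D.exists_progressionSum_eq_mul_of_classes (p - 1 - e) _ (fun i => p - 1 - e - i)
      (fun i => p - 1 - i)
      (fun i hi => ⟨by lia, by lia, Int.modEq_iff_dvd.2 ⟨0, by push_cast; ring⟩⟩)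
      (fun i hi => ⟨by lia, by lia, Int.modEq_iff_dvd.2 ⟨0, by push_cast; ring⟩⟩)
      fun i hi => by rw [if_pos (by lia), if_neg (by lia)]; rfl
  · exact D.exists_progressionSum_eq_mul_of_classes (-1) _ (fun i => p - 1 - i)
      (fun i => e - 1 - i)
      (fun i hi => ⟨by lia, by lia, Int.modEq_iff_dvd.2 ⟨-1, by push_cast; ring⟩⟩)
      (fun i hi => ⟨by lia, by lia, Int.modEq_iff_dvd.2 ⟨0, by push_cast; ring⟩⟩)
      fun i hi => by rw [if_neg (by lia), if_pos (by lia)]; rfl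

/-- With `j = p - 1 - e`, the progression from `j * q - p` to `j * q - p + u * e` just misses the
semigroup, while its terms decreased by `1` all lie in it. -/
theorem exists_progressionSum_eq_neg_add_one (D : StepInverse p q u e 1) :
    ∃ x : ℤ, 0 < x ∧ (p - 1 - e) * q < x + u * e ∧ x + u * e < p * q ∧
      progressionSum p q u x (e + 1) = -(e + 1) := by
  have he := D.one_le
  have hep := D.two_mul_lt
  have hu := D.u_pos
  have hup := D.mul_lt_q
  have hpu := D.lt_u
  have hue : u ≤ u * e := le_mul_of_one_le_right hu.le (by lia)
  have hue' : u * (e + 1) ≤ u * p := mul_le_mul_of_nonneg_left (by lia) hu.le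
  have hq : (0 : ℤ) < q := by linarith
  obtain ⟨j, hj⟩ : ∃ j : ℤ, j = p - 1 - e := ⟨_, rfl⟩
  have hj1 : q ≤ j * q := le_mul_of_one_le_left hq.le (by lia)
  have hj2 : (j + 1) * q ≤ p * q := mul_le_mul_of_nonneg_right (by lia) hq.le
  have hx : j * q - p ≡ j * q [ZMOD p] := by simp
  rw [← hj]
  refine ⟨j * q - p, by linarith, by linarith, by linarith, ?_⟩
  rw [progressionSum_eq_mul (ε := -1), Nat.cast_succ, mul_neg_one]
  intro i hi
  have hi0 : 0 ≤ u * i := by positivity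
  have hi' : u * i ≤ u * e := mul_le_mul_of_nonneg_left (by lia) hu.le
  have hterm : j * q - p + u * i ≡ (j + i) * q [ZMOD p] := by
    simpa using D.add_mul_sub_modEq hx (i := i) (s := 0) (j := j + i) (by simp)
  have hpred : j * q - p + u * i - 1 ≡ (j + i - e) * q [ZMOD p] :=
    D.add_mul_sub_modEq hx (by simp [add_sub_assoc])
  have hterm_lt : j * q - p + u * i < (j + i) * q := by
    rcases i.eq_zero_or_pos with rfl | hipos
    · simpa using D.p_pos
    · have := mul_le_mul_of_nonneg_right (show j + 1 ≤ j + i by lia) hq.le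
      linarith
  have hle_pred : (j + i - e) * q ≤ j * q - p + u * i - 1 := by
    rcases Nat.lt_succ_iff_lt_or_eq.1 hi with hie | rfl
    · have := mul_le_mul_of_nonneg_right (show j + i - e ≤ j - 1 by lia) hq.le
      linarith
    · rw [add_sub_cancel_right]
      linarith
  rw [binaryCoeff, semigroupIndicator_eq_ite D.coprime (by lia) (by lia) hterm,
    semigroupIndicator_eq_ite D.coprime (by lia) (by lia) hpred, if_neg hterm_lt.not_ge,
    if_pos hle_pred, zero_sub]

end StepInverse

end Realization

section Diameter

theorem maxCoeff_eq {f : ℤ[X]} {a : ℤ} (ha : 0 < a) (hle : ∀ n, f.coeff n ≤ a)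
    (hmax : ∃ n, f.coeff n = a) : maxCoeff f = a := by
  obtain ⟨n, rfl⟩ := hmax
  have hn : n ∈ Finset.range (f.natDegree + 1) :=
    Finset.mem_range.2 (Nat.lt_succ_of_le (le_natDegree_of_ne_zero ha.ne'))
  exact le_antisymm (Finset.sup'_le _ _ fun i _ => hle i) (Finset.le_sup' f.coeff hn)

theorem minCoeff_eq {f : ℤ[X]} {b : ℤ} (hb : b < 0) (hge : ∀ n, b ≤ f.coeff n)
    (hmin : ∃ n, f.coeff n = b) : minCoeff f = b := by
  obtain ⟨n, rfl⟩ := hmin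
  have hn : n ∈ Finset.range (f.natDegree + 1) :=
    Finset.mem_range.2 (Nat.lt_succ_of_le (le_natDegree_of_ne_zero hb.ne))
  exact le_antisymm (Finset.inf'_le f.coeff hn) (Finset.le_inf' _ _ fun i _ => hge i)

theorem cyclotomicDiameter_eq {n : ℕ} {a b : ℤ} (ha : 0 < a) (hb : 0 < b) (σ : ℤˣ)
    (hle : ∀ m, σ * (cyclotomic n ℤ).coeff m ≤ a) (hge : ∀ m, -b ≤ σ * (cyclotomic n ℤ).coeff m)
    (hmax : ∃ m, σ * (cyclotomic n ℤ).coeff m = a)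
    (hmin : ∃ m, σ * (cyclotomic n ℤ).coeff m = -b) :
    cyclotomicDiameter n = a + b := by
  rw [cyclotomicDiameter]
  rcases Int.units_eq_one_or σ with rfl | rfl
  · simp only [Units.val_one, one_mul] at hle hge hmax hmin
    rw [maxCoeff_eq ha hle hmax, minCoeff_eq (neg_lt_zero.2 hb) hge hmin, sub_neg_eq_add]
  · simp only [Units.val_neg, Units.val_one, neg_one_mul, neg_inj] at hle hge hmax hmin
    rw [maxCoeff_eq hb (fun m => neg_le_neg_iff.1 (hge m)) hmin,
      minCoeff_eq (neg_lt_zero.2 ha) (fun m => neg_le.1 (hle m))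
        (hmax.imp fun m hm => neg_eq_iff_eq_neg.1 hm), sub_neg_eq_add, add_comm]

theorem exists_pos_lt_modEq_of_mul_modEq_one {m : ℕ} (hm : 1 < m) {a b : ℤ}
    (h : a * b ≡ 1 [ZMOD m]) : ∃ v : ℤ, 0 < v ∧ v < m ∧ v ≡ a [ZMOD m] := by
  obtain ⟨v, hv0, hvm, hv⟩ := Int.existsUnique_equiv a (show (0 : ℤ) < m by lia)
  refine ⟨v, hv0.lt_of_ne ?_, hvm, hv⟩
  rintro rfl
  have hdvd : (m : ℤ) ∣ 1 := by simpa using ((hv.mul_right b).trans h).dvd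
  linarith [Int.le_of_dvd one_pos hdvd, (Nat.one_lt_cast (α := ℤ)).2 hm]

variable {p q r : ℕ} {u : ℤ} {e : ℕ} {η : ℤˣ}

namespace StepInverse

theorem exists_modEq_neg_mul (D : StepInverse p q u e η) :
    ∃ (σ : ℤˣ) (w : ℤ), w ≡ -σ * u [ZMOD p] ∧ 0 < w ∧ w ≤ p - 1 - e := by
  have hep := D.two_mul_lt
  obtain ⟨v, hv0, hvp, hv⟩ :=
    exists_pos_lt_modEq_of_mul_modEq_one (by linarith [D.one_le]) D.inverse
  rcases le_or_gt v (p - 1 - e) with h | h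
  · exact ⟨-1, v, by simpa using hv, by lia, h⟩
  · exact ⟨1, p - v, by simpa using (Int.modEq_zero_iff_dvd.2 dvd_rfl).sub hv, by lia, by lia⟩

theorem exists_coeff_eq_mul (D : StepInverse p q u e η) (S : ShortInverse p q r u) (ε : ℤˣ) :
    ∃ n, (cyclotomic (p * q * r) ℤ).coeff n = ε * e := by
  have hep := D.two_mul_lt
  obtain ⟨σ, w, hw, hw0, hwe⟩ := D.exists_modEq_neg_mul
  obtain ⟨x, hx, hxe, hsum⟩ := D.exists_progressionSum_eq_mul (σ * ε)
  have hue : 0 ≤ u * (e - 1) := mul_nonneg D.u_pos.le (by linarith [D.one_le])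
  have hwx : w * q ≤ (p - 1 - e) * q := mul_le_mul_of_nonneg_right hwe q.cast_nonneg
  have hwq : 0 ≤ w * q := by positivity
  obtain ⟨n, hn⟩ := S.exists_coeff_eq_of_progression hw hw0 (x := x) (M := e) (by linarith) (by lia)
    (by linarith) hxe
  refine ⟨n, ?_⟩
  calc (cyclotomic (p * q * r) ℤ).coeff n = σ * σ * (ε * e) := by rw [hn, hsum]; push_cast; ring
    _ = ε * e := by rw [Int.units_coe_mul_self, one_mul]

theorem cyclotomicDiameter_eq_two_mul (D : StepInverse p q u e (-1)) (S : ShortInverse p q r u) :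
    cyclotomicDiameter (p * q * r) = 2 * e := by
  have he : (0 : ℤ) < e := by exact_mod_cast D.one_le
  have hcoeff (n : ℕ) : |(cyclotomic (p * q * r) ℤ).coeff n| ≤ e := by
    obtain ⟨σ, w, x, M, -, -, -, hM, -, hn⟩ := S.exists_coeff_eq_mul_progressionSum n
    rw [hn, abs_mul, Int.isUnit_iff_abs_eq.1 σ.isUnit, one_mul]
    exact abs_le.2 ⟨D.neg_le_progressionSum x hM, D.progressionSum_le x M⟩
  rw [two_mul]
  refine cyclotomicDiameter_eq he he 1 (fun n => ?_) (fun n => ?_) ?_ ?_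
  · simpa using le_of_abs_le (hcoeff n)
  · simpa using neg_le_of_abs_le (hcoeff n)
  · simpa using D.exists_coeff_eq_mul S 1
  · simpa using D.exists_coeff_eq_mul S (-1)

/-- A coefficient of sign `-σ` comes from the shift `p - w`, so its progression contains none of the
multiples `j * q` with `e ≤ j < p - e` that a sum below `-e` requires. -/
theorem neg_le_mul_coeff_le (D : StepInverse p q u e 1) (S : ShortInverse p q r u) {σ : ℤˣ} {w : ℤ}
    (hw : w ≡ -σ * u [ZMOD p]) (hw0 : 0 < w) (hwe : w ≤ e) (n : ℕ) :
    -((e : ℤ) + 1) ≤ σ * (cyclotomic (p * q * r) ℤ).coeff n ∧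
      σ * (cyclotomic (p * q * r) ℤ).coeff n ≤ e := by
  have hq : (0 : ℤ) ≤ q := q.cast_nonneg
  obtain ⟨τ, z, x, M, hz, hz0, hzp, hM, hloc, hn⟩ := S.exists_coeff_eq_mul_progressionSum n
  have hle := D.progressionSum_le x M
  rw [hn]
  rcases eq_or_ne τ σ with rfl | hτ
  · rw [← mul_assoc, Int.units_coe_mul_self, one_mul]
    exact ⟨by linarith [D.neg_sub_one_le_progressionSum x hM], hle⟩
  obtain rfl : τ = -σ := Int.units_ne_iff_eq_neg.1 hτ
  have hzw : z = p - w := by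
    have hep := D.two_mul_lt
    have hmod : z + w ≡ 0 [ZMOD p] := by simpa using hz.add hw
    have := Int.eq_zero_of_abs_lt_dvd (m := p) (x := z + w - p)
      (dvd_sub_self_right.2 (Int.modEq_zero_iff_dvd.1 hmod)) (by rw [abs_lt]; lia)
    linarith
  have hge : -(e : ℤ) ≤ progressionSum p q u x M := by
    by_contra! hlt
    obtain ⟨j, hj, hjp, hxj, hjM⟩ := D.exists_mul_mem_of_progressionSum_lt hM hlt
    rcases hloc with h | h
    · have := mul_le_mul_of_nonneg_right (show p - z ≤ j by linarith) hq
      linarith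
    · have := mul_le_mul_of_nonneg_right (show j ≤ z - 1 by lia) hq
      linarith
  rw [Units.val_neg, neg_mul, mul_neg, ← mul_assoc, Int.units_coe_mul_self, one_mul]
  constructor <;> linarith

theorem cyclotomicDiameter_eq_two_mul_add_one (D : StepInverse p q u e 1)
    (S : ShortInverse p q r u) {σ : ℤˣ} {w : ℤ} (hw : w ≡ -σ * u [ZMOD p]) (hw0 : 0 < w)
    (hwe : w ≤ e) : cyclotomicDiameter (p * q * r) = 2 * e + 1 := by
  have he : (0 : ℤ) < e := by exact_mod_cast D.one_le
  have hep := D.two_mul_lt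
  have hcoeff := D.neg_le_mul_coeff_le S hw hw0 hwe
  rw [show (2 * e + 1 : ℤ) = e + (e + 1) by ring]
  refine cyclotomicDiameter_eq he (by lia) σ (fun n => (hcoeff n).2) (fun n => (hcoeff n).1) ?_ ?_
  · obtain ⟨n, hn⟩ := D.exists_coeff_eq_mul S σ
    exact ⟨n, by rw [hn, ← mul_assoc, Int.units_coe_mul_self, one_mul]⟩
  · obtain ⟨x, hx, hxe, hxp, hsum⟩ := D.exists_progressionSum_eq_neg_add_one
    have hwx : w * q ≤ (p - 1 - e) * q := mul_le_mul_of_nonneg_right (by lia) q.cast_nonneg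
    obtain ⟨n, hn⟩ := S.exists_coeff_eq_of_progression hw hw0 hx (M := e + 1) (by lia)
      (by push_cast; linarith) (by push_cast; linarith)
    exact ⟨n, by rw [hn, hsum, ← mul_assoc, Int.units_coe_mul_self, one_mul]⟩

end StepInverse

end Diameter

section Existence

theorem exists_shortInverse_and_stepInverse {p e : ℕ} (hp : p.Prime) (he : 1 ≤ e) (hep : 2 * e < p)
    (η : ℤˣ) (N : ℕ) :
    ∃ q r : ℕ, ∃ u : ℤ, N < q ∧ p < q ∧ q < r ∧ ShortInverse p q r u ∧ StepInverse p q u e η := by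
  obtain ⟨u, hpu, hue⟩ : ∃ u : ℕ, p < u ∧ (u : ℤ) * e ≡ 1 [ZMOD p] := by
    obtain ⟨v, hv⟩ := Int.mod_coprime (Nat.coprime_of_lt_prime (by lia) (by lia : e < p) hp).symm
    rw [mul_comm] at hv
    obtain ⟨w, hw0, -, hw⟩ := exists_pos_lt_modEq_of_mul_modEq_one hp.one_lt hv
    lift w to ℕ using hw0.le
    refine ⟨w + p, by lia, ((Int.ModEq.mul_right _ ?_).trans hv)⟩
    simpa using hw.add_right p
  have hup : IsCoprime (u : ℤ) p := by
    obtain ⟨k, hk⟩ := hue.dvd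
    exact ⟨e, k, by linarith⟩
  have hηu : IsCoprime (η * u : ℤ) p := (isCoprime_mul_unit_left_left η.isUnit _ _).2 hup
  obtain ⟨q, hNq, hq, hqu⟩ :=
    Nat.forall_exists_prime_gt_and_zmodEq (max N (u * p)) hp.ne_zero hηu
  rw [gt_iff_lt, max_lt_iff] at hNq
  have huq : u < q := by nlinarith [hp.one_lt]
  have hu_coprime : u.Coprime (p * q) := Nat.Coprime.mul_right
    (Nat.isCoprime_iff_coprime.1 hup) (Nat.coprime_of_lt_prime (by lia) huq hq).symm
  obtain ⟨v, hv⟩ := Int.mod_coprime hu_coprime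
  have hv_coprime : IsCoprime v (p * q : ℕ) := by
    obtain ⟨k, hk⟩ := hv.dvd
    exact ⟨u, k, by linarith⟩
  obtain ⟨r, hr_gt, hr, hrv⟩ := Nat.forall_exists_prime_gt_and_zmodEq (p * q)
    (mul_ne_zero hp.ne_zero hq.ne_zero) hv_coprime
  have hru : r * u ≡ 1 [ZMOD (p * q : ℕ)] := by
    rw [mul_comm (r : ℤ)]
    exact (hrv.mul_left u).trans hv
  exact ⟨q, r, u, hNq.1, by nlinarith, by nlinarith [hp.pos],
    ⟨hp, hq, hr, hr_gt, hru, by lia, by exact_mod_cast hNq.2⟩,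
    ⟨he, hep, by exact_mod_cast hpu, by exact_mod_cast hNq.2, hue, hqu⟩⟩

theorem exists_modEq_neg_mul_le {p e k : ℕ} {u : ℤ} (hpe : p = 2 * e + 2 * k + 1) (he : 1 ≤ e)
    (hkp : (2 * k + 1) ^ 2 ≤ p) (hu : u * e ≡ 1 [ZMOD p]) :
    ∃ (σ : ℤˣ) (w : ℤ), w ≡ -σ * u [ZMOD p] ∧ 0 < w ∧ w ≤ e := by
  obtain ⟨v, hv0, hvp, hv⟩ := exists_pos_lt_modEq_of_mul_modEq_one (by lia) hu
  rcases le_or_gt v e with h | h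
  · exact ⟨-1, v, by simpa using hv, by lia, h⟩
  rcases le_or_gt (p - v) e with h' | h'
  · exact ⟨1, p - v, by simpa using (Int.modEq_zero_iff_dvd.2 dvd_rfl).sub hv, by lia, h'⟩
  exfalso
  -- Since `2k + 1 ≡ -2e`, the odd number `(2v - p)(2k + 1)` is `-4` modulo `p`; it is too small.
  obtain ⟨c, hc⟩ := ((hv.mul_right _).trans hu).dvd
  have hdvd : (p : ℤ) ∣ (2 * v - p) * (2 * k + 1) + 4 := by
    refine ⟨2 * v - p + 2 * e + 4 * c, ?_⟩
    rw [show (2 * k + 1 : ℤ) = p - 2 * e by lia]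
    linear_combination 4 * hc
  have habs : |(2 * v - p) * (2 * k + 1) + 4| < (p : ℤ) := by
    have hk : (1 : ℤ) ≤ k := by lia
    zify at hkp
    have hlo := mul_nonneg (show 0 ≤ 2 * v - p + (2 * k - 1) by lia) (2 * k + 1).cast_nonneg
    have hhi := mul_nonneg (show 0 ≤ 2 * k - 1 - (2 * v - p) by lia) (2 * k + 1).cast_nonneg
    push_cast at hlo hhi
    rw [abs_lt]
    constructor <;> nlinarith
  have hodd : Odd ((2 * v - p) * (2 * k + 1) + 4 : ℤ) := by
    subst hpe
    push_cast
    grind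
  rw [Int.eq_zero_of_abs_lt_dvd hdvd habs] at hodd
  exact Int.not_odd_zero hodd

theorem solubleInLargePrimes_two_mul {p e : ℕ} (hp : p.Prime) (he : 1 ≤ e) (hep : 2 * e < p) :
    SolubleInLargePrimes p (2 * e) := fun N => by
  obtain ⟨q, r, u, hNq, hpq, hqr, S, D⟩ := exists_shortInverse_and_stepInverse hp he hep (-1) N
  exact ⟨q, r, S.prime_q, S.prime_r, hNq, hNq.trans hqr, hpq, hqr,
    D.cyclotomicDiameter_eq_two_mul S⟩

theorem solubleInLargePrimes_sub_two_mul {p k : ℕ} (hp : p.Prime) (hodd : Odd p)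
    (hkp : (2 * k + 1) ^ 2 ≤ p) : SolubleInLargePrimes p (p - 2 * k) := fun N => by
  obtain ⟨m, hm⟩ := hodd
  have hp2 := hp.two_le
  obtain ⟨e, rfl⟩ : ∃ e, m = e + k := Nat.exists_eq_add_of_le' (by nlinarith)
  have he : 1 ≤ e := by
    by_contra! he
    nlinarith
  obtain ⟨q, r, u, hNq, hpq, hqr, S, D⟩ :=
    exists_shortInverse_and_stepInverse hp he (by lia) 1 N
  obtain ⟨σ, w, hw, hw0, hwe⟩ := exists_modEq_neg_mul_le (by lia) he hkp D.inverse
  refine ⟨q, r, S.prime_q, S.prime_r, hNq, hNq.trans hqr, hpq, hqr, ?_⟩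
  rw [D.cyclotomicDiameter_eq_two_mul_add_one S hw hw0 hwe]
  lia

theorem two_mul_lt_of_lt_sqrt {p h : ℕ} (hh : 2 ≤ h) (hhp : (h : ℝ) < √p) : 2 * h < p := by
  have hsq : h ^ 2 < p := by exact_mod_cast (Real.lt_sqrt h.cast_nonneg).1 hhp
  nlinarith

theorem sq_two_mul_add_one_le_of_lt_sqrt {p k : ℕ} (hk : (k : ℝ) < √p / 2 - 1) :
    (2 * k + 1) ^ 2 ≤ p := by
  have hsq : (2 * k + 2) ^ 2 < p := by
    exact_mod_cast (Real.lt_sqrt (by positivity)).1 (show (2 * k + 2 : ℝ) < √p by linarith)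
  exact (Nat.pow_le_pow_left (by lia) 2).trans hsq.le

end Existence

theorem corollary7_general (p : ℕ) (hp : p.Prime) (hodd : Odd p) :
    (∀ h : ℕ, 1 ≤ h → 2 * h < p → SolubleInLargePrimes p (2 * h)) ∧
    (∀ k : ℕ, (2 * k + 1) ^ 2 ≤ p → SolubleInLargePrimes p (p - 2 * k)) :=
  ⟨fun _ => solubleInLargePrimes_two_mul hp, fun _ => solubleInLargePrimes_sub_two_mul hp hodd⟩

theorem corollary7 (p : ℕ) (hp : p.Prime) (hodd : Odd p) :
    SolubleInLargePrimes p 2 ∧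
    (∀ h : ℕ, 3 ≤ h → (h : ℝ) < Real.sqrt (p : ℝ) →
      SolubleInLargePrimes p (2 * (h : ℤ))) ∧
    SolubleInLargePrimes p (p : ℤ) ∧
    (∀ k : ℕ, 1 ≤ k → (k : ℝ) < Real.sqrt (p : ℝ) / 2 - 1 →
      SolubleInLargePrimes p ((p : ℤ) - 2 * (k : ℤ))) := by
  obtain ⟨heven, hsub⟩ := corollary7_general p hp hodd
  refine ⟨?_, fun h hh hhp => ?_, ?_, fun k _ hkp => ?_⟩
  · exact heven 1 le_rfl (by have := hp.two_le; grind)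
  · exact heven h (by lia) (two_mul_lt_of_lt_sqrt (by lia) hhp)
  · simpa using hsub 0 hp.one_le
  · exact hsub k (sq_two_mul_add_one_le_of_lt_sqrt hkp)
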